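/- Let $G$ be a locally compact Polish group and let $(X,\mathcal B,m)$ be a standard probability space. Let $T$ be a non-singular action of $G$ on $(X,\mathcal B,m)$, i.e. a homomorphism $g\mapsto T_g$ from $G$ to the group of invertible non-singular transformations of $(X,\mathcal B,m)$ (modulo equality $m$-almost everywhere), such that the unitary operators $$U_g f=\sqrt{\frac{d(m\circ T_g)}{dm}}\cdot f\circ T_g,\qquad f\in L^2(X,m;\mathbb C),$$ depend continuously on $g$ in the weak operator topology. (Since $U_gU_h=U_{hg}$, the map $g\mapsto U_{g^{-1}}$ is a continuous unitary representation of $G$, the Koopman representation.) Recall that a bounded continuous function $\varphi:G\to\mathbb C$ is weakly almost periodic if the orbit $\{\varphi(g\,\cdot):g\in G\}$ is relatively compact in the weak topology of the Banach space $C_b(G)$, and that the space $WAP(G)$ of these functions carries a unique left and right $G$-invariant mean $\mathfrak m$. A continuous unitary representation $\pi$ of $G$ on a Hilbert space $\mathcal H$ is weakly mixing if for all $f_1,f_2\in\mathcal H$ the function $g\mapsto|\langle\pi(g)f_1,f_2\rangle|$ (which lies in $WAP(G)$) satisfies $\mathfrak m(|\langle\pi(\cdot)f_1,f_2\rangle|)=0$.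 If there is no probability measure $\mu$ on $(X,\mathcal B)$ that is absolutely continuous with respect to $m$ and satisfies $\mu(T_gB)=\mu(B)$ for all $g\in G$ and $B\in\mathcal B$, then the Koopman representation $g\mapsto U_{g^{-1}}$ is weakly mixing; likewise, for all $f_1,f_2\in L^2(X,m;\mathbb C)$, the function $g\mapsto|\langle U_gf_1,f_2\rangle|$ lies in $WAP(G)$ and $\mathfrak m(|\langle U_{\cdot}f_1,f_2\rangle|)=0$. -/

import Mathlib

open MeasureTheory Filter Topology
open scoped ENNReal ComplexOrder BoundedContinuousFunction

noncomputable section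

/-! ### Weakly almost periodic functions, invariant means, weakly mixing representations -/

section WeaklyMixing

variable (G : Type*) [Group G] [TopologicalSpace G] [IsTopologicalGroup G]

/-- The translate `f_g`, `f_g (h) = f (g h)`. -/
def leftTranslate {G : Type*} [Group G] [TopologicalSpace G] [IsTopologicalGroup G]
    (g : G) (f : G →ᵇ ℂ) : G →ᵇ ℂ :=
  f.compContinuous ⟨fun h => g * h, continuous_const.mul continuous_id⟩

/-- `f` is weakly almost periodic: its orbit `{f_g : g ∈ G}` is relatively compact for the weak
topology of the Banach space of bounded continuous functions on `G`. -/
def IsWeaklyAlmostPeriodic {G : Type*} [Group G] [TopologicalSpace G] [IsTopologicalGroup G]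
    (f : G →ᵇ ℂ) : Prop :=
  IsCompact (closure (Set.range fun g : G => toWeakSpace ℂ (G →ᵇ ℂ) (leftTranslate g f)))

/-- The space `WAP(G)` of weakly almost periodic functions on `G`. -/
def WAP : Submodule ℂ (G →ᵇ ℂ) where
  carrier := {f | IsWeaklyAlmostPeriodic f}
  zero_mem' := by
    have h : (Set.range fun g : G => toWeakSpace ℂ (G →ᵇ ℂ) (leftTranslate g 0)) ⊆ {0} := by
      rintro _ ⟨g, rfl⟩
      rfl
    exact (isCompact_singleton (x := (0 : WeakSpace ℂ (G →ᵇ ℂ)))).closure_of_subset h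
  add_mem' := by
    intro a b ha hb
    refine (ha.add hb).closure_of_subset ?_
    rintro _ ⟨g, rfl⟩
    exact Set.add_mem_add (subset_closure (Set.mem_range_self g))
      (subset_closure (Set.mem_range_self g))
  smul_mem' := by
    intro c a ha
    refine (IsCompact.smul c ha).closure_of_subset ?_
    rintro _ ⟨g, rfl⟩
    exact Set.smul_mem_smul_set (subset_closure (Set.mem_range_self g))

/-- `M` is a left and right invariant mean on `WAP(G)`. The algebra `WAP(G)` carries exactly one
such functional. -/
structure IsInvariantMean (M : WAP G →ₗ[ℂ] ℂ) : Prop where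
  map_conj : ∀ f f' : WAP G, (∀ h, f'.1 h = starRingEnd ℂ (f.1 h)) → M f' = starRingEnd ℂ (M f)
  map_nonneg : ∀ f : WAP G, (∀ h, 0 ≤ f.1 h) → 0 ≤ M f
  map_one : ∀ f : WAP G, (∀ h, f.1 h = 1) → M f = 1
  map_left : ∀ (g : G) (f f' : WAP G), (∀ h, f'.1 h = f.1 (g * h)) → M f' = M f
  map_right : ∀ (g : G) (f f' : WAP G), (∀ h, f'.1 h = f.1 (h * g)) → M f' = M f

/-- `φ` is a weakly almost periodic function, and its invariant mean equals `c`. -/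
def HasInvariantMean {G : Type*} [Group G] [TopologicalSpace G] [IsTopologicalGroup G]
    (φ : G → ℂ) (c : ℂ) : Prop :=
  ∃ f : WAP G, (∀ g, f.1 g = φ g) ∧ ∀ M : WAP G →ₗ[ℂ] ℂ, IsInvariantMean G M → M f = c

/-- A unitary representation `π` of `G` on a complex Hilbert space is continuous (for the strong
operator topology) and weakly mixing: `|⟨π(g) f₁, f₂⟩|` has invariant mean zero for all vectors
`f₁, f₂`. -/
structure IsWeaklyMixingRep {G : Type*} [Group G] [TopologicalSpace G] [IsTopologicalGroup G]
    {H : Type*} [NormedAddCommGroup H] [InnerProductSpace ℂ H] [CompleteSpace H]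
    (π : G →* (H ≃ₗᵢ[ℂ] H)) : Prop where
  continuous : ∀ f : H, Continuous fun g => π g f
  mean_zero : ∀ f₁ f₂ : H, HasInvariantMean (fun g => ((‖inner ℂ (π g f₁) f₂‖ : ℝ) : ℂ)) 0

end WeaklyMixing

/-! ### Non-singular transformations and their Koopman operators -/

/-- An invertible non-singular transformation of `(X, m)`. Two of them are regarded as equal when
they agree `m`-almost everywhere. -/
structure NST {X : Type*} [MeasurableSpace X] (m : Measure X) where
  toEquiv : X ≃ᵐ X
  null_iff : ∀ C : Set X, MeasurableSet C → (m C = 0 ↔ m (toEquiv ⁻¹' C) = 0)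

namespace NST

variable {X : Type*} [MeasurableSpace X] {m : Measure X}

instance : CoeFun (NST m) fun _ => X → X := ⟨fun T => T.toEquiv⟩

/-- The measure `m ∘ T`, that is `B ↦ m (T B)`. -/
def compMeasure (T : NST m) : Measure X := m.map T.toEquiv.symm

theorem compMeasure_apply (T : NST m) (B : Set X) : T.compMeasure B = m (T '' B) := by
  rw [compMeasure, T.toEquiv.symm.map_apply, ← MeasurableEquiv.image_eq_preimage_symm]

instance (T : NST m) [IsProbabilityMeasure m] : IsProbabilityMeasure T.compMeasure :=
  Measure.isProbabilityMeasure_map T.toEquiv.symm.measurable.aemeasurable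

theorem quasi (T : NST m) : Measure.QuasiMeasurePreserving T m m :=
  ⟨T.toEquiv.measurable, Measure.AbsolutelyContinuous.mk fun s hs h0 => by
    rw [T.toEquiv.map_apply]; exact (T.null_iff s hs).1 h0⟩

theorem compMeasure_ac (T : NST m) : T.compMeasure ≪ m :=
  Measure.AbsolutelyContinuous.mk fun s hs h0 => by
    rw [compMeasure, T.toEquiv.symm.map_apply]
    refine (T.null_iff _ (T.toEquiv.symm.measurable hs)).2 ?_
    rw [← Set.preimage_comp, MeasurableEquiv.symm_comp_self]
    exact h0

theorem map_compMeasure (T : NST m) : T.compMeasure.map T = m := by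
  rw [compMeasure, Measure.map_map T.toEquiv.measurable T.toEquiv.symm.measurable]
  simp

/-- The inverse transformation. -/
def symm (T : NST m) : NST m :=
  ⟨T.toEquiv.symm, fun C hC => by
    rw [T.null_iff _ (T.toEquiv.symm.measurable hC), ← Set.preimage_comp,
      MeasurableEquiv.symm_comp_self]; rfl⟩

/-- The function `√(d(m ∘ T)/dm) · f ∘ T`. -/
def koopmanFun (T : NST m) (f : X → ℂ) : X → ℂ := fun x =>
  ((Real.sqrt (T.compMeasure.rnDeriv m x).toReal : ℝ) : ℂ) * f (T x)

theorem koopmanFun_congr (T : NST m) {f f' : X → ℂ} (h : f =ᵐ[m] f') :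
    T.koopmanFun f =ᵐ[m] T.koopmanFun f' := by
  filter_upwards [T.quasi.ae h] with x hx
  simp only [koopmanFun, hx]

theorem aestronglyMeasurable_koopmanFun (T : NST m) {f : X → ℂ} (hf : AEStronglyMeasurable f m) :
    AEStronglyMeasurable (T.koopmanFun f) m := by
  refine AEStronglyMeasurable.mul ?_ (hf.comp_quasiMeasurePreserving T.quasi)
  have h : Measurable fun x => T.compMeasure.rnDeriv m x := Measure.measurable_rnDeriv _ _
  exact (Complex.measurable_ofReal.comp h.ennreal_toReal.sqrt).aestronglyMeasurable

variable [IsProbabilityMeasure m]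

theorem eLpNorm_koopmanFun (T : NST m) {f : X → ℂ} (hf : AEStronglyMeasurable f m) :
    eLpNorm (T.koopmanFun f) 2 m = eLpNorm f 2 m := by
  rw [eLpNorm_eq_lintegral_rpow_enorm_toReal two_ne_zero ENNReal.ofNat_ne_top,
    eLpNorm_eq_lintegral_rpow_enorm_toReal two_ne_zero ENNReal.ofNat_ne_top]
  congr 1
  have h1 : ∫⁻ x, ‖f x‖ₑ ^ (2 : ℝ≥0∞).toReal ∂m
      = ∫⁻ x, ‖f (T x)‖ₑ ^ (2 : ℝ≥0∞).toReal ∂T.compMeasure := by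
    conv_lhs => rw [← T.map_compMeasure]
    exact T.toEquiv.measurableEmbedding.lintegral_map _
  have h2 : AEMeasurable (fun x => ‖f (T x)‖ₑ ^ (2 : ℝ≥0∞).toReal) m :=
    (hf.comp_quasiMeasurePreserving T.quasi).enorm.pow_const _
  rw [h1, ← lintegral_rnDeriv_mul T.compMeasure_ac h2]
  refine lintegral_congr_ae ?_
  filter_upwards [Measure.rnDeriv_lt_top T.compMeasure m] with x hx
  have h3 : ‖((Real.sqrt (T.compMeasure.rnDeriv m x).toReal : ℝ) : ℂ)‖ₑ ^ 2
      = T.compMeasure.rnDeriv m x := by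
    rw [← ofReal_norm, Complex.norm_of_nonneg (Real.sqrt_nonneg _),
      ← ENNReal.ofReal_pow (Real.sqrt_nonneg _), Real.sq_sqrt ENNReal.toReal_nonneg,
      ENNReal.ofReal_toReal hx.ne]
  simp only [koopmanFun, enorm_mul, ENNReal.toReal_ofNat, ENNReal.rpow_ofNat, mul_pow, h3]

theorem memLp_koopmanFun (T : NST m) {f : X → ℂ} (hf : MemLp f 2 m) :
    MemLp (T.koopmanFun f) 2 m :=
  ⟨T.aestronglyMeasurable_koopmanFun hf.1, by rw [T.eLpNorm_koopmanFun hf.1]; exact hf.2⟩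

/-- The chain rule for the functions `√(d(m ∘ T)/dm) · f ∘ T`. -/
theorem koopmanFun_koopmanFun (S T R : NST m) (h : ∀ᵐ x ∂m, R x = T (S x)) (f : X → ℂ) :
    S.koopmanFun (T.koopmanFun f) =ᵐ[m] R.koopmanFun f := by
  have hR : R.compMeasure = T.compMeasure.map S.toEquiv.symm := by
    ext B hB
    rw [S.toEquiv.symm.map_apply, compMeasure, compMeasure, R.toEquiv.symm.map_apply,
      T.toEquiv.symm.map_apply]
    refine measure_congr ?_
    have h' : ∀ᵐ y ∂m, R (R.symm y) = T (S (R.symm y)) := R.symm.quasi.ae h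
    filter_upwards [h'] with y hy
    have e1 : R (R.symm y) = y := R.toEquiv.apply_symm_apply y
    have e2 : S.toEquiv.symm (T.toEquiv.symm y) = R.toEquiv.symm y := by
      rw [e1] at hy
      conv_lhs => rw [hy]
      simp [symm]
    have e3 : (R.toEquiv.symm y ∈ B) = (S.toEquiv.symm (T.toEquiv.symm y) ∈ B) := by rw [e2]
    exact e3
  have h1 := S.toEquiv.symm.measurableEmbedding.rnDeriv_map T.compMeasure m
  have h2 : ∀ᵐ x ∂m, R.compMeasure.rnDeriv S.compMeasure x = T.compMeasure.rnDeriv m (S x) := by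
    have h3 := S.quasi.ae h1
    filter_upwards [h3] with x hx
    rw [← hx, hR, S.toEquiv.symm_apply_apply]
    rfl
  have hac : R.compMeasure ≪ S.compMeasure := by
    rw [hR]; exact T.compMeasure_ac.map S.toEquiv.symm.measurable
  filter_upwards [h, h2, Measure.rnDeriv_mul_rnDeriv (κ := m) hac] with x hx hx2 hx3
  simp only [koopmanFun]
  rw [← hx, ← hx2, ← hx3, Pi.mul_apply, ENNReal.toReal_mul, Real.sqrt_mul ENNReal.toReal_nonneg,
    Complex.ofReal_mul]
  ring

theorem koopmanFun_id (R : NST m) (h : ∀ᵐ x ∂m, R x = x) (f : X → ℂ) :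
    R.koopmanFun f =ᵐ[m] f := by
  have hR : R.compMeasure = m := by
    ext B hB
    rw [compMeasure, R.toEquiv.symm.map_apply]
    refine measure_congr ?_
    have h' : ∀ᵐ y ∂m, R (R.symm y) = R.symm y := R.symm.quasi.ae h
    filter_upwards [h'] with y hy
    have e1 : R (R.symm y) = y := R.toEquiv.apply_symm_apply y
    rw [e1] at hy
    have e3 : (R.symm y ∈ B) = (y ∈ B) := by rw [← hy]
    exact e3
  have h2 : R.compMeasure.rnDeriv m =ᵐ[m] 1 := by rw [hR]; exact Measure.rnDeriv_self m
  filter_upwards [h, h2] with x hx hx2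
  simp [koopmanFun, hx, hx2]

/-- The Koopman operator `U_T f = √(d(m ∘ T)/dm) · f ∘ T` on `L²(X, m)`, as a map. -/
def koopmanMap (T : NST m) (f : Lp ℂ 2 m) : Lp ℂ 2 m := (T.memLp_koopmanFun (Lp.memLp f)).toLp _

theorem coeFn_koopmanMap (T : NST m) (f : Lp ℂ 2 m) :
    T.koopmanMap f =ᵐ[m] T.koopmanFun f := MemLp.coeFn_toLp _

theorem koopmanMap_koopmanMap (S T R : NST m) (h : ∀ᵐ x ∂m, R x = T (S x)) (f : Lp ℂ 2 m) :
    S.koopmanMap (T.koopmanMap f) = R.koopmanMap f :=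
  Lp.ext <| (S.coeFn_koopmanMap _).trans <| (S.koopmanFun_congr (T.coeFn_koopmanMap f)).trans <|
    (koopmanFun_koopmanFun S T R h f).trans (R.coeFn_koopmanMap f).symm

theorem koopmanMap_id (R : NST m) (h : ∀ᵐ x ∂m, R x = x) (f : Lp ℂ 2 m) :
    R.koopmanMap f = f :=
  Lp.ext <| (R.coeFn_koopmanMap _).trans (R.koopmanFun_id h f)

/-- The identity transformation. -/
def refl (m : Measure X) : NST m := ⟨MeasurableEquiv.refl X, fun _ _ => Iff.rfl⟩

/-- The Koopman operator `U_T f = √(d(m ∘ T)/dm) · f ∘ T`, a unitary operator on `L²(X, m)`. -/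
def koopman (T : NST m) : Lp ℂ 2 m ≃ₗᵢ[ℂ] Lp ℂ 2 m where
  toFun := T.koopmanMap
  invFun := T.symm.koopmanMap
  map_add' f f' := by
    refine Lp.ext ?_
    filter_upwards [T.coeFn_koopmanMap (f + f'), T.coeFn_koopmanMap f, T.coeFn_koopmanMap f',
      Lp.coeFn_add (T.koopmanMap f) (T.koopmanMap f'), T.koopmanFun_congr (Lp.coeFn_add f f')]
      with x h1 h2 h3 h4 h5
    rw [h1, h5, h4, Pi.add_apply, h2, h3]
    simp only [koopmanFun, Pi.add_apply, mul_add]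
  map_smul' c f := by
    refine Lp.ext ?_
    filter_upwards [T.coeFn_koopmanMap (c • f), T.coeFn_koopmanMap f,
      Lp.coeFn_smul c (T.koopmanMap f), T.koopmanFun_congr (Lp.coeFn_smul c f)] with x h1 h2 h3 h4
    rw [h1, h4, RingHom.id_apply, h3, Pi.smul_apply, h2]
    simp only [koopmanFun, Pi.smul_apply, smul_eq_mul]
    ring
  left_inv f := by
    rw [koopmanMap_koopmanMap T.symm T (refl m)
      (Eventually.of_forall fun x => (T.toEquiv.apply_symm_apply x).symm)]
    exact koopmanMap_id _ (Eventually.of_forall fun _ => rfl) f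
  right_inv f := by
    rw [koopmanMap_koopmanMap T T.symm (refl m)
      (Eventually.of_forall fun x => (T.toEquiv.symm_apply_apply x).symm)]
    exact koopmanMap_id _ (Eventually.of_forall fun _ => rfl) f
  norm_map' f := by
    change ‖T.koopmanMap f‖ = ‖f‖
    rw [Lp.norm_def, Lp.norm_def, eLpNorm_congr_ae (T.coeFn_koopmanMap f),
      T.eLpNorm_koopmanFun (Lp.aestronglyMeasurable f)]

theorem coeFn_koopman (T : NST m) (f : Lp ℂ 2 m) :
    T.koopman f =ᵐ[m]
      fun x => ((Real.sqrt (T.compMeasure.rnDeriv m x).toReal : ℝ) : ℂ) * f (T x) :=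
  T.coeFn_koopmanMap f

end NST

/-! ### Non-singular actions -/

/-- A non-singular action of `G` on `(X, m)`: a homomorphism from `G` to the group of invertible
non-singular transformations (modulo null sets), continuous for the topology which that group
inherits through `T ↦ U_T` from the weak operator topology. -/
structure NonsingularAction (G : Type*) [Group G] [TopologicalSpace G]
    {X : Type*} [MeasurableSpace X] (m : Measure X) [IsProbabilityMeasure m] where
  toFun : G → NST m
  map_mul : ∀ g h : G, ∀ᵐ x ∂m, toFun (g * h) x = toFun g (toFun h x)
  continuous : ∀ f₁ f₂ : Lp ℂ 2 m, Continuous fun g => inner ℂ ((toFun g).koopman f₁) f₂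

namespace NonsingularAction

variable {G : Type*} [Group G] [TopologicalSpace G]
  {X : Type*} [MeasurableSpace X] {m : Measure X} [IsProbabilityMeasure m]

instance : CoeFun (NonsingularAction G m) fun _ => G → NST m := ⟨NonsingularAction.toFun⟩

theorem map_one (T : NonsingularAction G m) : ∀ᵐ x ∂m, T 1 x = x := by
  filter_upwards [T.map_mul 1 1] with x hx
  rw [mul_one] at hx
  exact ((T 1).toEquiv.injective hx).symm

/-- The Koopman representation of the action `T`. As `U_{T_g} U_{T_h} = U_{T_{hg}}`, the
homomorphism is `g ↦ U_{T_{g⁻¹}}`. -/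
def koopmanRep (T : NonsingularAction G m) : G →* (Lp ℂ 2 m ≃ₗᵢ[ℂ] Lp ℂ 2 m) where
  toFun g := (T g⁻¹).koopman
  map_one' := by
    ext1 f
    refine NST.koopmanMap_id _ ?_ f
    rw [inv_one]
    exact T.map_one
  map_mul' g h := by
    ext1 f
    refine (NST.koopmanMap_koopmanMap (T g⁻¹) (T h⁻¹) (T (g * h)⁻¹) ?_ f).symm
    rw [mul_inv_rev]
    exact T.map_mul h⁻¹ g⁻¹

/-- `μ` is a `T`-invariant probability measure which is absolutely continuous with respect to
`m`. -/
structure IsACIP (T : NonsingularAction G m) (μ : Measure X) : Prop where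
  prob : IsProbabilityMeasure μ
  ac : μ ≪ m
  invariant : ∀ (g : G) (B : Set X), MeasurableSet B → μ (T g '' B) = μ B

end NonsingularAction

end

noncomputable section

/-! ### Almost orthogonal families in a Hilbert space -/

section AlmostOrthogonal

variable {H : Type*} [NormedAddCommGroup H] [InnerProductSpace ℂ H]

/-! The contrapositive is proved: a coefficient with non-zero mean modulus produces an invariant
probability measure. Write `π` for the Koopman representation and suppose that `|⟨π(·)f, u⟩|` has
non-zero mean under an invariant mean `M`. Then `|⟨π(·)f, u⟩|²` has non-zero mean too
(`mean_norm_eq_zero`). Averaging the rank one operators `x ↦ ⟨π(g)f, x⟩ π(g)f` over `g` gives a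
positive operator `A` of trace at most `‖f‖²`. It is non-zero, Hilbert–Schmidt, and commutes with
`π` by left invariance of `M` (`exists_hilbertSchmidt_intertwiner`).

Put `ν(B) = ‖1_B A‖²` in the Hilbert–Schmidt norm. This is a finite non-zero measure with `ν ≪ m`.
Moving `B` by `T_g` amounts to conjugating `1_B` by the Koopman operator, which commutes with `A`;
since the Hilbert–Schmidt norm does not depend on the orthonormal basis, `ν` is invariant
(`hilbertSchmidtMeasure_image`). Normalising `ν` contradicts the hypothesis.

The averages make sense because moduli and squared moduli of coefficients are weakly almost
periodic. Their translates lie in the image of a weak-* compact ball of functionals, under a map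
into `C_b(G)` that is shown to be weakly continuous (`continuousOn_coefficientFun`) by an almost
orthogonality argument. -/

theorem exists_norm_le_one_mul_eq_norm (z : ℂ) : ∃ c : ℂ, ‖c‖ ≤ 1 ∧ c * z = (‖z‖ : ℂ) := by
  by_cases hz : z = 0
  · exact ⟨0, by simp, by simp [hz]⟩
  · have hn : (‖z‖ : ℂ) ≠ 0 := by simpa using hz
    refine ⟨starRingEnd ℂ z / ‖z‖, ?_, ?_⟩
    · rw [norm_div, RCLike.norm_conj, Complex.norm_real, norm_norm]
      exact div_self_le_one _
    · rw [div_mul_eq_mul_div, div_eq_iff hn, Complex.conj_mul', sq]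

/-- In the Gram expansion the `N` diagonal terms contribute at most `N R²`, and the at most `N²`
off-diagonal ones, each of size at most `1/N`, contribute at most `N`. -/
theorem sq_norm_sum_smul_le {N : ℕ} {R : ℝ} (η : ℕ → H) (c : ℕ → ℂ) (hc : ∀ k, ‖c k‖ ≤ 1)
    (hR : ∀ k, ‖η k‖ ≤ R) (ho : ∀ i j, i < j → ‖inner ℂ (η i) (η j)‖ ≤ 1 / (N : ℝ)) :
    ‖∑ k ∈ Finset.range N, c k • η k‖ ^ 2 ≤ N * (R ^ 2 + 1) := by
  have hpair : ∀ i j, ‖inner ℂ (c i • η i) (c j • η j)‖ ≤ (if i = j then R ^ 2 else 0) + 1 / N := by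
    intro i j
    have h1 : ‖inner ℂ (c i • η i) (c j • η j)‖ ≤ ‖inner ℂ (η i) (η j)‖ := by
      rw [inner_smul_left, inner_smul_right, norm_mul, norm_mul, RCLike.norm_conj, ← mul_assoc]
      exact mul_le_of_le_one_left (norm_nonneg _)
        (mul_le_one₀ (hc i) (norm_nonneg _) (hc j))
    refine h1.trans ?_
    have hN : (0 : ℝ) ≤ 1 / N := by positivity
    rcases lt_trichotomy i j with h | h | h
    · simpa [h.ne] using ho i j h
    · subst h
      rw [if_pos rfl]
      have h2 : ‖inner ℂ (η i) (η i)‖ ≤ R ^ 2 := by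
        refine (norm_inner_le_norm _ _).trans ?_
        rw [sq]
        exact mul_le_mul (hR i) (hR i) (norm_nonneg _) ((norm_nonneg _).trans (hR i))
      linarith
    · rw [norm_inner_symm]
      simpa [h.ne'] using ho j i h
  have hself : ‖∑ k ∈ Finset.range N, c k • η k‖ ^ 2
      = ‖inner ℂ (∑ k ∈ Finset.range N, c k • η k) (∑ k ∈ Finset.range N, c k • η k)‖ := by
    rw [inner_self_eq_norm_sq_to_K, norm_pow]
    simp
  rw [hself, sum_inner]
  simp only [inner_sum]
  calc _ ≤ ∑ i ∈ Finset.range N, ∑ j ∈ Finset.range N, ((if i = j then R ^ 2 else 0) + 1 / (N : ℝ)) :=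
        (norm_sum_le _ _).trans (Finset.sum_le_sum fun i _ =>
          (norm_sum_le _ _).trans (Finset.sum_le_sum fun j _ => hpair i j))
    _ = ∑ i ∈ Finset.range N, (R ^ 2 + N * (1 / (N : ℝ))) := by
        refine Finset.sum_congr rfl fun i hi => ?_
        rw [Finset.sum_add_distrib, Finset.sum_ite_eq, if_pos hi]
        simp
    _ ≤ ∑ i ∈ Finset.range N, (R ^ 2 + 1) := by
        refine Finset.sum_le_sum fun i _ => ?_
        -- An inequality rather than an equality, so that `N = 0` with `1 / 0 = 0` is covered.
        have : (N : ℝ) * (1 / (N : ℝ)) ≤ 1 := by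
          rw [mul_one_div]
          exact div_self_le_one _
        linarith
    _ = _ := by simp [mul_add]

/-- Suitable phases turn the sum into one inner product with `v`, to which Cauchy–Schwarz applies.
What matters is the growth `√N` instead of the trivial `N`. -/
theorem sum_norm_inner_le_of_almost_orthogonal {N : ℕ} {R : ℝ} (η : ℕ → H)
    (hR : ∀ k, ‖η k‖ ≤ R) (ho : ∀ i j, i < j → ‖inner ℂ (η i) (η j)‖ ≤ 1 / (N : ℝ)) (v : H) :
    ∑ k ∈ Finset.range N, ‖inner ℂ (η k) v‖ ≤ √(N * (R ^ 2 + 1)) * ‖v‖ := by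
  choose c hc1 hc2 using fun k => exists_norm_le_one_mul_eq_norm (inner ℂ (η k) v)
  have h1 : inner ℂ (∑ k ∈ Finset.range N, starRingEnd ℂ (c k) • η k) v
      = ((∑ k ∈ Finset.range N, ‖inner ℂ (η k) v‖ : ℝ) : ℂ) := by
    rw [sum_inner, Complex.ofReal_sum]
    refine Finset.sum_congr rfl fun k _ => ?_
    rw [inner_smul_left, Complex.conj_conj, hc2]
  have h2 : ∑ k ∈ Finset.range N, ‖inner ℂ (η k) v‖
      = ‖inner ℂ (∑ k ∈ Finset.range N, starRingEnd ℂ (c k) • η k) v‖ := by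
    rw [h1, Complex.norm_of_nonneg (Finset.sum_nonneg fun _ _ => norm_nonneg _)]
  rw [h2]
  refine (norm_inner_le_norm _ _).trans (mul_le_mul_of_nonneg_right ?_ (norm_nonneg v))
  exact Real.le_sqrt_of_sq_le (sq_norm_sum_smul_le η _ (fun k => by simpa using hc1 k) hR ho)

end AlmostOrthogonal

/-! ### Functions of matrix coefficients are weakly almost periodic -/

section Coefficients

variable {G : Type*} [TopologicalSpace G] {H : Type*} [NormedAddCommGroup H]
  [InnerProductSpace ℂ H]

/-- `Ψ` is Lipschitz on bounded sets. -/
def IsBoundedlyLipschitz (Ψ : ℂ → ℂ) : Prop :=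
  ∀ R : ℝ, ∃ L : ℝ, 0 ≤ L ∧ ∀ a b : ℂ, ‖a‖ ≤ R → ‖b‖ ≤ R → ‖Ψ a - Ψ b‖ ≤ L * ‖a - b‖

theorem IsBoundedlyLipschitz.continuous {Ψ : ℂ → ℂ} (hΨ : IsBoundedlyLipschitz Ψ) :
    Continuous Ψ := by
  refine continuous_iff_continuousAt.2 fun a => ?_
  obtain ⟨L, -, hL⟩ := hΨ (‖a‖ + 1)
  refine tendsto_iff_norm_sub_tendsto_zero.2 ?_
  have h1 : Tendsto (fun b => L * ‖b - a‖) (𝓝 a) (𝓝 0) := by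
    have : Continuous fun b => L * ‖b - a‖ := by fun_prop
    simpa using this.tendsto a
  refine squeeze_zero' (Eventually.of_forall fun _ => norm_nonneg _) ?_ h1
  have h2 : ∀ᶠ b in 𝓝 a, ‖b‖ < ‖a‖ + 1 :=
    continuous_norm.continuousAt.eventually_lt continuousAt_const (by simp)
  filter_upwards [h2] with b hb
  exact hL b a hb.le (by linarith)

theorem isBoundedlyLipschitz_norm : IsBoundedlyLipschitz fun z => (‖z‖ : ℂ) := fun R =>
  ⟨1, zero_le_one, fun a b _ _ => by
    rw [← Complex.ofReal_sub, Complex.norm_real, one_mul]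
    exact abs_norm_sub_norm_le a b⟩

theorem isBoundedlyLipschitz_norm_sq : IsBoundedlyLipschitz fun z => ((‖z‖ ^ 2 : ℝ) : ℂ) := fun R =>
  ⟨2 * |R|, by positivity, fun a b ha hb => by
    rw [← Complex.ofReal_sub, Complex.norm_real, sq_sub_sq, norm_mul, Real.norm_eq_abs,
      Real.norm_eq_abs, abs_of_nonneg (by positivity)]
    have hR := le_abs_self R
    exact mul_le_mul (by linarith) (abs_norm_sub_norm_le a b) (abs_nonneg _) (by positivity)⟩

/-- The bounded continuous function `g ↦ Ψ (ξ (v g))`, for a bounded continuous map `v` into a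
Hilbert space. -/
def coefficientFun {Ψ : ℂ → ℂ} (hΨ : IsBoundedlyLipschitz Ψ) (v : G →ᵇ H) (ξ : StrongDual ℂ H) :
    G →ᵇ ℂ :=
  BoundedContinuousFunction.ofNormedAddCommGroup (fun g => Ψ (ξ (v g)))
    (hΨ.continuous.comp (ξ.continuous.comp v.continuous))
    ((hΨ (‖ξ‖ * ‖v‖)).choose * (‖ξ‖ * ‖v‖) + ‖Ψ 0‖) (by
      intro g
      have hR : ‖ξ (v g)‖ ≤ ‖ξ‖ * ‖v‖ :=
        (ξ.le_opNorm _).trans (mul_le_mul_of_nonneg_left (v.norm_coe_le_norm g) (norm_nonneg _))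
      obtain ⟨hL, h⟩ := (hΨ (‖ξ‖ * ‖v‖)).choose_spec
      have h1 := h (ξ (v g)) 0 hR (by simp; positivity)
      rw [sub_zero] at h1
      have h2 : ‖Ψ (ξ (v g))‖ ≤ ‖Ψ (ξ (v g)) - Ψ 0‖ + ‖Ψ 0‖ := by
        simpa using norm_add_le (Ψ (ξ (v g)) - Ψ 0) (Ψ 0)
      have h3 := mul_le_mul_of_nonneg_left hR hL
      linarith)

theorem coefficientFun_apply {Ψ : ℂ → ℂ} (hΨ : IsBoundedlyLipschitz Ψ) (v : G →ᵇ H)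
    (ξ : StrongDual ℂ H) (g : G) : coefficientFun hΨ v ξ g = Ψ (ξ (v g)) := rfl

variable [CompleteSpace H]

/-- A bounded functional varies little along one of the members of a bounded almost orthogonal
family of perturbations. -/
theorem card_mul_le_of_almost_orthogonal {Ψ : ℂ → ℂ} (hΨ : IsBoundedlyLipschitz Ψ) (v : G →ᵇ H)
    (R : ℝ) : ∃ C : ℝ, 0 ≤ C ∧ ∀ (ℓ : StrongDual ℂ (G →ᵇ ℂ)) (N : ℕ) (δ : ℝ) (ξ : StrongDual ℂ H)
      (ξ' : ℕ → StrongDual ℂ H), ‖ξ‖ ≤ R → (∀ k, ‖ξ' k‖ ≤ R) →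
      (∀ i j, i < j → ‖(ξ' j - ξ) ((InnerProductSpace.toDual ℂ H).symm (ξ' i - ξ))‖ ≤ 1 / (N : ℝ)) →
      (∀ k, δ ≤ ‖ℓ (coefficientFun hΨ v (ξ' k) - coefficientFun hΨ v ξ)‖) →
      N * δ ≤ ‖ℓ‖ * (C * √N) := by
  obtain ⟨L, hL0, hL⟩ := hΨ (R * ‖v‖)
  -- `L` is the Lipschitz constant of `Ψ` on the disc containing all values `ζ (v g)` with `‖ζ‖ ≤
  -- R`; `2 * R` bounds the differences `ξ' k - ξ`.
  refine ⟨L * (√((2 * R) ^ 2 + 1) * ‖v‖), by positivity, ?_⟩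
  intro ℓ N δ ξ ξ' hξ hξ' ho hδ
  have hbd : ∀ ζ : StrongDual ℂ H, ‖ζ‖ ≤ R → ∀ g, ‖ζ (v g)‖ ≤ R * ‖v‖ := fun ζ hζ g =>
    (ζ.le_opNorm _).trans
      (mul_le_mul hζ (v.norm_coe_le_norm g) (norm_nonneg _) ((norm_nonneg _).trans hζ))
  set η : ℕ → H := fun k => (InnerProductSpace.toDual ℂ H).symm (ξ' k - ξ) with hη
  have hηR : ∀ k, ‖η k‖ ≤ 2 * R := fun k => by
    rw [hη, LinearIsometryEquiv.norm_map]
    exact (norm_sub_le _ _).trans (by linarith [hξ' k])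
  have hηo : ∀ i j, i < j → ‖inner ℂ (η i) (η j)‖ ≤ 1 / (N : ℝ) := fun i j hij => by
    rw [norm_inner_symm, hη, InnerProductSpace.toDual_symm_apply]
    exact ho i j hij
  choose c hc1 hc2 using fun k => exists_norm_le_one_mul_eq_norm
    (ℓ (coefficientFun hΨ v (ξ' k) - coefficientFun hΨ v ξ))
  -- The phases `c k` make `ℓ F` the sum of the moduli, hence at least `N * δ`, while almost
  -- orthogonality keeps the sup norm of `F` of order `√N`.
  set F : G →ᵇ ℂ := ∑ k ∈ Finset.range N,
    c k • (coefficientFun hΨ v (ξ' k) - coefficientFun hΨ v ξ) with hF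
  have hFn : ‖F‖ ≤ L * (√((2 * R) ^ 2 + 1) * ‖v‖) * √N := by
    refine (BoundedContinuousFunction.norm_le (by positivity)).2 fun g => ?_
    rw [hF, BoundedContinuousFunction.coe_sum, Finset.sum_apply]
    have h1 : ∀ k, ‖(c k • (coefficientFun hΨ v (ξ' k) - coefficientFun hΨ v ξ)) g‖
        ≤ L * ‖inner ℂ (η k) (v g)‖ := fun k => by
      rw [BoundedContinuousFunction.coe_smul, norm_smul, BoundedContinuousFunction.sub_apply,
        coefficientFun_apply, coefficientFun_apply, hη, InnerProductSpace.toDual_symm_apply,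
        sub_apply]
      exact (mul_le_of_le_one_left (norm_nonneg _) (hc1 k)).trans
        (hL _ _ (hbd _ (hξ' k) g) (hbd _ hξ g))
    calc _ ≤ ∑ k ∈ Finset.range N, L * ‖inner ℂ (η k) (v g)‖ :=
          (norm_sum_le _ _).trans (Finset.sum_le_sum fun k _ => h1 k)
      _ = L * ∑ k ∈ Finset.range N, ‖inner ℂ (η k) (v g)‖ := (Finset.mul_sum _ _ _).symm
      _ ≤ L * (√(N * ((2 * R) ^ 2 + 1)) * ‖v g‖) :=
          mul_le_mul_of_nonneg_left (sum_norm_inner_le_of_almost_orthogonal η hηR hηo _) hL0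
      _ ≤ L * (√(N * ((2 * R) ^ 2 + 1)) * ‖v‖) := by
          gcongr
          exact v.norm_coe_le_norm g
      _ = _ := by
          rw [Real.sqrt_mul (Nat.cast_nonneg N)]
          ring
  have hℓ : ℓ F = ((∑ k ∈ Finset.range N,
      ‖ℓ (coefficientFun hΨ v (ξ' k) - coefficientFun hΨ v ξ)‖ : ℝ) : ℂ) := by
    rw [hF, map_sum, Complex.ofReal_sum]
    exact Finset.sum_congr rfl fun k _ => by rw [map_smul, smul_eq_mul, hc2]
  calc N * δ = ∑ k ∈ Finset.range N, δ := by simp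
    _ ≤ ∑ k ∈ Finset.range N, ‖ℓ (coefficientFun hΨ v (ξ' k) - coefficientFun hΨ v ξ)‖ :=
        Finset.sum_le_sum fun k _ => hδ k
    _ = ‖ℓ F‖ := by
        rw [hℓ, Complex.norm_of_nonneg (Finset.sum_nonneg fun _ _ => norm_nonneg _)]
    _ ≤ ‖ℓ‖ * ‖F‖ := ℓ.le_opNorm F
    _ ≤ _ := mul_le_mul_of_nonneg_left hFn (norm_nonneg _)

/-- If continuity failed at `ξ`, functionals weak-* close to `ξ` would change the value of `ℓ` by at
least `δ`. Choosing them one after another, almost orthogonally, gives `N δ ≤ const · √N`, which is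
false for large `N`. -/
theorem continuousOn_coefficientFun {Ψ : ℂ → ℂ} (hΨ : IsBoundedlyLipschitz Ψ) (v : G →ᵇ H)
    (R : ℝ) (ℓ : StrongDual ℂ (G →ᵇ ℂ)) :
    ContinuousOn (fun ξ : WeakDual ℂ H => ℓ (coefficientFun hΨ v (WeakDual.toStrongDual ξ)))
      (WeakDual.toStrongDual ⁻¹' Metric.closedBall (0 : StrongDual ℂ H) R) := by
  intro ξ hξ
  refine Metric.tendsto_nhds.2 fun δ hδ => ?_
  by_contra hcon
  obtain ⟨C, hC0, hC⟩ := card_mul_le_of_almost_orthogonal hΨ v R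
  obtain ⟨N, hN⟩ := exists_nat_gt ((‖ℓ‖ * C / δ) ^ 2)
  have hN0 : (0 : ℝ) < N := lt_of_le_of_lt (sq_nonneg _) hN
  have hexists : ∀ s : Finset (WeakDual ℂ H), ∃ ξ' : WeakDual ℂ H,
      (WeakDual.toStrongDual ξ' ∈ Metric.closedBall (0 : StrongDual ℂ H) R ∧
        δ ≤ ‖ℓ (coefficientFun hΨ v (WeakDual.toStrongDual ξ')
          - coefficientFun hΨ v (WeakDual.toStrongDual ξ))‖) ∧
      ∀ ζ ∈ s, ‖(WeakDual.toStrongDual ξ' - WeakDual.toStrongDual ξ)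
        ((InnerProductSpace.toDual ℂ H).symm
          (WeakDual.toStrongDual ζ - WeakDual.toStrongDual ξ))‖ ≤ 1 / (N : ℝ) := by
    intro s
    have hev : ∀ᶠ ξ' in 𝓝[WeakDual.toStrongDual ⁻¹' Metric.closedBall (0 : StrongDual ℂ H) R] ξ,
        ∀ ζ ∈ s, ‖(WeakDual.toStrongDual ξ' - WeakDual.toStrongDual ξ)
        ((InnerProductSpace.toDual ℂ H).symm
          (WeakDual.toStrongDual ζ - WeakDual.toStrongDual ξ))‖ ≤ 1 / (N : ℝ) := by
      refine nhdsWithin_le_nhds ((Filter.eventually_all_finset s).2 fun ζ _ => ?_)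
      have h1 := (WeakDual.eval_continuous (𝕜 := ℂ) ((InnerProductSpace.toDual ℂ H).symm
          (WeakDual.toStrongDual ζ - WeakDual.toStrongDual ξ))).tendsto ξ
      have h2 := Metric.tendsto_nhds.1 h1 (1 / (N : ℝ)) (by positivity)
      filter_upwards [h2] with ξ' hξ'
      rw [dist_eq_norm] at hξ'
      exact hξ'.le
    obtain ⟨ξ', h1, h2, h3⟩ :=
      ((Filter.not_eventually.1 hcon).and_eventually (hev.and self_mem_nhdsWithin)).exists
    refine ⟨ξ', ⟨h3, ?_⟩, h2⟩
    rw [not_lt, dist_eq_norm, ← map_sub] at h1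
    exact h1
  -- Each new functional is weak-* close to `ξ` on the finitely many vectors representing the
  -- earlier differences; this is the almost orthogonality.
  obtain ⟨ξ', h1, h2⟩ := exists_seq_of_forall_finset_exists _ _ fun s _ => hexists s
  have key := hC ℓ N δ (WeakDual.toStrongDual ξ) (fun k => WeakDual.toStrongDual (ξ' k))
    (by simpa using hξ) (fun k => by simpa using (h1 k).1) h2 fun k => (h1 k).2
  have hs : (0 : ℝ) < √N := Real.sqrt_pos.2 hN0
  have h3 : √N * δ ≤ ‖ℓ‖ * C := by
    refine le_of_mul_le_mul_right ?_ hs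
    calc √N * δ * √N = (√N * √N) * δ := by ring
      _ = N * δ := by rw [Real.mul_self_sqrt hN0.le]
      _ ≤ _ := key
      _ = _ := by ring
  have h4 : √(N : ℝ) ≤ ‖ℓ‖ * C / δ := (le_div_iff₀ hδ).2 h3
  have h5 : (N : ℝ) ≤ (‖ℓ‖ * C / δ) ^ 2 := (Real.sqrt_le_left (by positivity)).1 h4
  linarith

/-- Banach–Alaoglu, together with weak continuity tested on one functional `ℓ` at a time. -/
theorem isCompact_image_coefficientFun {Ψ : ℂ → ℂ} (hΨ : IsBoundedlyLipschitz Ψ) (v : G →ᵇ H)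
    (R : ℝ) :
    IsCompact ((fun ξ : WeakDual ℂ H =>
        toWeakSpace ℂ (G →ᵇ ℂ) (coefficientFun hΨ v (WeakDual.toStrongDual ξ))) ''
      (WeakDual.toStrongDual ⁻¹' Metric.closedBall (0 : StrongDual ℂ H) R)) := by
  refine (WeakDual.isCompact_closedBall (0 : StrongDual ℂ H) R).image_of_continuousOn ?_
  rw [continuousOn_iff_continuous_domRestrict]
  refine WeakBilin.continuous_of_continuous_eval _ fun ℓ => ?_
  exact continuousOn_iff_continuous_domRestrict.1 (continuousOn_coefficientFun hΨ v R ℓ)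

variable [Group G] [IsTopologicalGroup G]

/-- The orbit map `g ↦ π g f` of a strongly continuous unitary representation. -/
def orbitMap (π : G →* (H ≃ₗᵢ[ℂ] H)) (hπ : ∀ f : H, Continuous fun g => π g f) (f : H) : G →ᵇ H :=
  BoundedContinuousFunction.ofNormedAddCommGroup (fun g => π g f) (hπ f) ‖f‖ fun g => by simp

/-- Translating by `h` replaces `ξ` by `ξ ∘ π h`, which has the same norm, so the whole orbit lies
in the compact image of one ball. -/
theorem isWeaklyAlmostPeriodic_coefficientFun {Ψ : ℂ → ℂ} (hΨ : IsBoundedlyLipschitz Ψ)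
    (π : G →* (H ≃ₗᵢ[ℂ] H)) (hπ : ∀ f : H, Continuous fun g => π g f) (f : H)
    (ξ : StrongDual ℂ H) :
    IsWeaklyAlmostPeriodic (coefficientFun hΨ (orbitMap π hπ f) ξ) := by
  refine (isCompact_image_coefficientFun hΨ (orbitMap π hπ f) ‖ξ‖).closure_of_subset ?_
  rintro _ ⟨h, rfl⟩
  refine ⟨StrongDual.toWeakDual (ξ.comp ((π h).toContinuousLinearEquiv : H →L[ℂ] H)), ?_, ?_⟩
  · simp
  · simp only [StrongDual.toStrongDual_toWeakDual]
    congr 1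
    ext g
    change Ψ (ξ (π h (π g f))) = Ψ (ξ (π (h * g) f))
    rw [map_mul]
    rfl

end Coefficients

/-! ### The averaged rank one operators of a unitary representation -/

section Averaging

variable {G : Type*} [Group G] [TopologicalSpace G] {H : Type*} [NormedAddCommGroup H] [InnerProductSpace ℂ H]
  (π : G →* (H ≃ₗᵢ[ℂ] H)) (hπ : ∀ f : H, Continuous fun g => π g f)

/-- The function `g ↦ ⟨u, π(g) f⟩ ⟨π(g) f, w⟩`. -/
def rankOneFun (f u w : H) : G →ᵇ ℂ :=
  BoundedContinuousFunction.ofNormedAddCommGroup (fun g => inner ℂ u (π g f) * inner ℂ (π g f) w)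
    ((continuous_const.inner (hπ f)).mul ((hπ f).inner continuous_const))
    (‖u‖ * ‖f‖ * (‖f‖ * ‖w‖)) fun g => by
      rw [norm_mul]
      have h1 := norm_inner_le_norm (𝕜 := ℂ) u (π g f)
      have h2 := norm_inner_le_norm (𝕜 := ℂ) (π g f) w
      rw [LinearIsometryEquiv.norm_map] at h1 h2
      exact mul_le_mul h1 h2 (norm_nonneg _) (by positivity)

theorem rankOneFun_apply (f u w : H) (g : G) :
    rankOneFun π hπ f u w g = inner ℂ u (π g f) * inner ℂ (π g f) w := rfl

theorem rankOneFun_self_apply (f u : H) (g : G) :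
    rankOneFun π hπ f u u g = ((‖inner ℂ u (π g f)‖ ^ 2 : ℝ) : ℂ) := by
  rw [rankOneFun_apply, ← inner_conj_symm (π g f) u, Complex.mul_conj']
  push_cast
  rfl

/-- Reduces membership in `WAP G` to squared moduli of coefficients, so that no closure of `WAP G`
under products is needed. -/
theorem rankOneFun_polarization (f u w : H) :
    rankOneFun π hπ f u w = (1 / 4 : ℂ) • (rankOneFun π hπ f (u + w) (u + w)
      - rankOneFun π hπ f (u - w) (u - w)
      - Complex.I • rankOneFun π hπ f (u + Complex.I • w) (u + Complex.I • w)
      + Complex.I • rankOneFun π hπ f (u - Complex.I • w) (u - Complex.I • w)) := by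
  ext g
  simp only [BoundedContinuousFunction.coe_smul, BoundedContinuousFunction.add_apply,
    BoundedContinuousFunction.sub_apply, rankOneFun_apply, inner_add_left, inner_add_right,
    inner_sub_left, inner_sub_right, inner_smul_left, inner_smul_right, smul_eq_mul,
    Complex.conj_I]
  linear_combination
    ((inner ℂ u (π g f) * inner ℂ (π g f) w - inner ℂ w (π g f) * inner ℂ (π g f) u) / 2)
      * Complex.I_sq

variable [IsTopologicalGroup G] [CompleteSpace H]

theorem rankOneFun_self_mem_WAP (f u : H) : rankOneFun π hπ f u u ∈ WAP G := by
  have h := isWeaklyAlmostPeriodic_coefficientFun isBoundedlyLipschitz_norm_sq π hπ f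
    (InnerProductSpace.toDual ℂ H u)
  have e : rankOneFun π hπ f u u = coefficientFun isBoundedlyLipschitz_norm_sq
      (orbitMap π hπ f) (InnerProductSpace.toDual ℂ H u) := by
    ext g
    exact rankOneFun_self_apply π hπ f u g
  rw [e]
  exact h

theorem rankOneFun_mem_WAP (f u w : H) : rankOneFun π hπ f u w ∈ WAP G := by
  rw [rankOneFun_polarization]
  have h := rankOneFun_self_mem_WAP π hπ f
  exact Submodule.smul_mem _ _ (Submodule.add_mem _ (Submodule.sub_mem _ (Submodule.sub_mem _
    (h _) (h _)) (Submodule.smul_mem _ _ (h _))) (Submodule.smul_mem _ _ (h _)))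

theorem const_mem_WAP (c : ℂ) : BoundedContinuousFunction.const G c ∈ WAP G := by
  have h : (Set.range fun g : G => toWeakSpace ℂ (G →ᵇ ℂ)
      (leftTranslate g (BoundedContinuousFunction.const G c)))
      ⊆ {toWeakSpace ℂ (G →ᵇ ℂ) (BoundedContinuousFunction.const G c)} := by
    rintro _ ⟨g, rfl⟩
    rfl
  exact isCompact_singleton.closure_of_subset h

namespace IsInvariantMean

variable {M : WAP G →ₗ[ℂ] ℂ} (hM : IsInvariantMean G M)
include hM

theorem mono {f f' : WAP G} (h : ∀ g, f.1 g ≤ f'.1 g) : M f ≤ M f' := by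
  rw [← sub_nonneg, ← map_sub]
  exact hM.map_nonneg _ fun g => sub_nonneg.2 (h g)

theorem map_const (c : ℂ) : M ⟨BoundedContinuousFunction.const G c, const_mem_WAP c⟩ = c := by
  have h1 : M ⟨BoundedContinuousFunction.const G 1, const_mem_WAP 1⟩ = 1 := hM.map_one _ fun _ => rfl
  have h2 : (⟨BoundedContinuousFunction.const G c, const_mem_WAP c⟩ : WAP G)
      = c • ⟨BoundedContinuousFunction.const G 1, const_mem_WAP 1⟩ := by
    ext g
    simp
  rw [h2, map_smul, h1, smul_eq_mul, mul_one]

theorem le_const {f : WAP G} {c : ℂ} (h : ∀ g, f.1 g ≤ c) : M f ≤ c := by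
  rw [← hM.map_const c]
  exact hM.mono h

end IsInvariantMean

/-- The sesquilinear form `(u, w) ↦ M(⟨u, π(·) f⟩ ⟨π(·) f, w⟩)`. -/
def averagedForm (M : WAP G →ₗ[ℂ] ℂ) (f u w : H) : ℂ :=
  M ⟨rankOneFun π hπ f u w, rankOneFun_mem_WAP π hπ f u w⟩

section Form

variable (M : WAP G →ₗ[ℂ] ℂ) (f : H)

theorem averagedForm_add_left (u u' w : H) : averagedForm π hπ M f (u + u') w
    = averagedForm π hπ M f u w + averagedForm π hπ M f u' w := by
  rw [averagedForm, averagedForm, averagedForm, ← map_add]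
  congr 1
  ext g
  simp [rankOneFun_apply, add_mul]

theorem averagedForm_add_right (u w w' : H) : averagedForm π hπ M f u (w + w')
    = averagedForm π hπ M f u w + averagedForm π hπ M f u w' := by
  rw [averagedForm, averagedForm, averagedForm, ← map_add]
  congr 1
  ext g
  simp [rankOneFun_apply, mul_add]

theorem averagedForm_smul_left (c : ℂ) (u w : H) : averagedForm π hπ M f (c • u) w
    = starRingEnd ℂ c * averagedForm π hπ M f u w := by
  rw [averagedForm, averagedForm, ← smul_eq_mul, ← map_smul]
  congr 1
  ext g
  simp [rankOneFun_apply, mul_assoc, mul_left_comm]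

theorem averagedForm_smul_right (c : ℂ) (u w : H) : averagedForm π hπ M f u (c • w)
    = c * averagedForm π hπ M f u w := by
  rw [averagedForm, averagedForm, ← smul_eq_mul, ← map_smul]
  congr 1
  ext g
  simp [rankOneFun_apply, mul_left_comm]

variable {M} (hM : IsInvariantMean G M)
include hM

theorem averagedForm_self_nonneg (u : H) : 0 ≤ averagedForm π hπ M f u u := by
  refine hM.map_nonneg _ fun g => ?_
  change 0 ≤ rankOneFun π hπ f u u g
  rw [rankOneFun_self_apply, Complex.zero_le_real]
  positivity

theorem conj_averagedForm (u w : H) :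
    starRingEnd ℂ (averagedForm π hπ M f w u) = averagedForm π hπ M f u w := by
  refine (hM.map_conj _ _ fun g => ?_).symm
  change rankOneFun π hπ f u w g = starRingEnd ℂ (rankOneFun π hπ f w u g)
  rw [rankOneFun_apply, rankOneFun_apply, map_mul, inner_conj_symm, inner_conj_symm, mul_comm]

/-- The trace bound: Bessel's inequality for `π g f`, uniform in `g`, averaged by `M`. -/
theorem sum_averagedForm_le {ι : Type*} {e : ι → H} (he : Orthonormal ℂ e) (s : Finset ι) :
    ∑ i ∈ s, (averagedForm π hπ M f (e i) (e i)).re ≤ ‖f‖ ^ 2 := by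
  have h1 : ∑ i ∈ s, averagedForm π hπ M f (e i) (e i)
      = M (∑ i ∈ s, ⟨rankOneFun π hπ f (e i) (e i), rankOneFun_mem_WAP π hπ f (e i) (e i)⟩) := by
    rw [map_sum]
    rfl
  have h2 : ∑ i ∈ s, averagedForm π hπ M f (e i) (e i) ≤ ((‖f‖ ^ 2 : ℝ) : ℂ) := by
    rw [h1]
    refine hM.le_const fun g => ?_
    rw [Submodule.coe_sum, BoundedContinuousFunction.coe_sum, Finset.sum_apply]
    simp only [rankOneFun_self_apply]
    rw [← Complex.ofReal_sum, Complex.real_le_real]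
    simpa using he.sum_inner_products_le (π g f) (s := s)
  have h3 := (Complex.le_def.1 h2).1
  rwa [Complex.re_sum, Complex.ofReal_re] at h3

theorem re_averagedForm_self_le (u : H) :
    (averagedForm π hπ M f u u).re ≤ ‖f‖ ^ 2 * ‖u‖ ^ 2 := by
  have h2 : averagedForm π hπ M f u u ≤ ((‖f‖ ^ 2 * ‖u‖ ^ 2 : ℝ) : ℂ) := by
    refine hM.le_const fun g => ?_
    change rankOneFun π hπ f u u g ≤ _
    rw [rankOneFun_self_apply, Complex.real_le_real, ← mul_pow, mul_comm]
    refine pow_le_pow_left₀ (norm_nonneg _) ?_ 2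
    simpa using norm_inner_le_norm (𝕜 := ℂ) u (π g f)
  simpa only [Complex.ofReal_re] using (Complex.le_def.1 h2).1

theorem norm_averagedForm_sq_le (u w : H) : ‖averagedForm π hπ M f u w‖ ^ 2
    ≤ (averagedForm π hπ M f u u).re * (averagedForm π hπ M f w w).re := by
  -- The form is positive but possibly degenerate; a pre-inner product is enough for Cauchy–Schwarz.
  let core : PreInnerProductSpace.Core ℂ H :=
    { inner := averagedForm π hπ M f
      conj_inner_symm := conj_averagedForm π hπ f hM
      re_inner_nonneg := fun u => (Complex.le_def.1 (averagedForm_self_nonneg π hπ f hM u)).1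
      add_left := averagedForm_add_left π hπ M f
      smul_left := fun u w c => averagedForm_smul_left π hπ M f c u w }
  have h := @InnerProductSpace.Core.inner_mul_inner_self_le ℂ H _ _ _ core u w
  have h1 : ‖averagedForm π hπ M f w u‖ = ‖averagedForm π hπ M f u w‖ := by
    rw [← conj_averagedForm π hπ f hM u w, RCLike.norm_conj]
  change ‖averagedForm π hπ M f u w‖ * ‖averagedForm π hπ M f w u‖ ≤ _ at h
  rw [h1, ← sq] at h
  exact h

theorem norm_averagedForm_le (u w : H) :
    ‖averagedForm π hπ M f u w‖ ≤ ‖f‖ ^ 2 * ‖u‖ * ‖w‖ := by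
  refine abs_le_of_sq_le_sq' ?_ (by positivity) |>.2
  calc _ ≤ _ := norm_averagedForm_sq_le π hπ f hM u w
    _ ≤ (‖f‖ ^ 2 * ‖u‖ ^ 2) * (‖f‖ ^ 2 * ‖w‖ ^ 2) :=
        mul_le_mul (re_averagedForm_self_le π hπ f hM u) (re_averagedForm_self_le π hπ f hM w)
          (Complex.le_def.1 (averagedForm_self_nonneg π hπ f hM w)).1 (by positivity)
    _ = _ := by ring

theorem averagedForm_apply_apply (h : G) (u w : H) :
    averagedForm π hπ M f (π h u) (π h w) = averagedForm π hπ M f u w := by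
  refine (hM.map_left h _ _ fun g => ?_).symm
  change rankOneFun π hπ f u w g = rankOneFun π hπ f (π h u) (π h w) (h * g)
  have e : π (h * g) f = π h (π g f) := by
    rw [map_mul]
    rfl
  simp only [rankOneFun_apply, e, LinearIsometryEquiv.inner_map_map]

/-- If the mean square of a matrix coefficient vanishes, so does the mean of its modulus. -/
theorem mean_norm_eq_zero (u : H) (h0 : averagedForm π hπ M f u u = 0) (F : WAP G)
    (hF : ∀ g, F.1 g = (‖inner ℂ u (π g f)‖ : ℂ)) : M F = 0 := by
  have hpos : 0 ≤ M F := hM.map_nonneg _ fun g => by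
    rw [hF, Complex.zero_le_real]
    exact norm_nonneg _
  have hle : ∀ t : ℝ, 0 < t → (M F).re ≤ t := by
    intro t ht
    -- Pointwise `a ≤ a² / t + t`; the mean of the square vanishes and `t` is arbitrarily small.
    have h1 : M F ≤ M ((t⁻¹ : ℂ) • ⟨rankOneFun π hπ f u u, rankOneFun_mem_WAP π hπ f u u⟩
        + ⟨BoundedContinuousFunction.const G (t : ℂ), const_mem_WAP _⟩) := by
      refine hM.mono fun g => ?_
      change F.1 g ≤ (t⁻¹ : ℂ) * rankOneFun π hπ f u u g + t
      rw [hF, rankOneFun_self_apply, ← Complex.ofReal_inv, ← Complex.ofReal_mul,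
        ← Complex.ofReal_add, Complex.real_le_real]
      set a := ‖inner ℂ u (π g f)‖
      rw [← sub_nonneg]
      have : t⁻¹ * a ^ 2 + t - a = t⁻¹ * ((a - t / 2) ^ 2 + 3 / 4 * t ^ 2) := by
        field_simp
        ring
      rw [this]
      positivity
    rw [map_add, map_smul, hM.map_const] at h1
    change M F ≤ (t⁻¹ : ℂ) • averagedForm π hπ M f u u + t at h1
    rw [h0, smul_zero, zero_add] at h1
    simpa using (Complex.le_def.1 h1).1
  have hre : (M F).re = 0 := le_antisymm (le_of_forall_pos_le_add fun t ht => by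
    simpa using hle t ht) (Complex.le_def.1 hpos).1
  exact Complex.ext hre (Complex.le_def.1 hpos).2.symm

/-- A unitary representation with a matrix coefficient whose modulus has non-zero mean commutes
with a non-zero Hilbert–Schmidt operator. -/
theorem exists_hilbertSchmidt_intertwiner (hπ : ∀ f : H, Continuous fun g => π g f) (u : H) (F : WAP G)
    (hF : ∀ g, F.1 g = (‖inner ℂ u (π g f)‖ : ℂ)) (hMF : M F ≠ 0) :
    ∃ A : H →L[ℂ] H, A ≠ 0 ∧ (∀ g x, A (π g x) = π g (A x)) ∧
      ∃ C : ℝ, ∀ (ι : Type _) (e : ι → H), Orthonormal ℂ e →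
        ∀ s : Finset ι, ∑ i ∈ s, ‖A (e i)‖ ^ 2 ≤ C := by
  let B : H →L⋆[ℂ] H →L[ℂ] ℂ := LinearMap.mkContinuous₂
    (LinearMap.mk₂'ₛₗ (starRingEnd ℂ) (RingHom.id ℂ) (averagedForm π hπ M f)
      (averagedForm_add_left π hπ M f) (averagedForm_smul_left π hπ M f)
      (averagedForm_add_right π hπ M f) (averagedForm_smul_right π hπ M f))
    (‖f‖ ^ 2) (norm_averagedForm_le π hπ f hM)
  let A : H →L[ℂ] H := InnerProductSpace.continuousLinearMapOfBilin B
  have hA : ∀ x w, inner ℂ (A x) w = averagedForm π hπ M f x w := fun x w =>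
    InnerProductSpace.continuousLinearMapOfBilin_apply B x w
  refine ⟨A, ?_, ?_, ‖f‖ ^ 2 * ‖f‖ ^ 2, ?_⟩
  · intro h
    refine hMF (mean_norm_eq_zero π hπ f hM u ?_ F hF)
    rw [← hA, h]
    simp
  · intro g x
    refine ext_inner_right ℂ fun w => ?_
    obtain ⟨w, rfl⟩ := (π g).surjective w
    rw [hA, averagedForm_apply_apply π hπ f hM, LinearIsometryEquiv.inner_map_map, hA]
  · intro ι e he s
    -- Cauchy–Schwarz for the form at `x` and `A x`, divided by `‖A x‖ ^ 2`. It bounds the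
    -- Hilbert–Schmidt sum by `‖f‖ ^ 2` times the trace.
    have h1 : ∀ x, ‖A x‖ ^ 2 ≤ ‖f‖ ^ 2 * (averagedForm π hπ M f x x).re := by
      intro x
      have h2 := norm_averagedForm_sq_le π hπ f hM x (A x)
      rw [← hA, inner_self_eq_norm_sq_to_K] at h2
      have h3 := re_averagedForm_self_le π hπ f hM (A x)
      have h4 := (Complex.le_def.1 (averagedForm_self_nonneg π hπ f hM x)).1
      rw [Complex.zero_re] at h4
      rcases (sq_nonneg ‖A x‖).eq_or_lt with h5 | h5
      · rw [← h5]
        positivity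
      · refine le_of_mul_le_mul_right ?_ h5
        calc ‖A x‖ ^ 2 * ‖A x‖ ^ 2 = ‖((‖A x‖ : ℝ) : ℂ) ^ 2‖ ^ 2 := by
              rw [norm_pow, Complex.norm_real, norm_norm]
              ring
          _ ≤ _ := h2
          _ ≤ (averagedForm π hπ M f x x).re * (‖f‖ ^ 2 * ‖A x‖ ^ 2) :=
              mul_le_mul_of_nonneg_left h3 h4
          _ = _ := by ring
    calc _ ≤ ∑ i ∈ s, ‖f‖ ^ 2 * (averagedForm π hπ M f (e i) (e i)).re :=
          Finset.sum_le_sum fun i _ => h1 (e i)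
      _ = ‖f‖ ^ 2 * ∑ i ∈ s, (averagedForm π hπ M f (e i) (e i)).re := (Finset.mul_sum _ _ _).symm
      _ ≤ _ := mul_le_mul_of_nonneg_left (sum_averagedForm_le π hπ f hM he s) (by positivity)

end Form

end Averaging

/-! ### Hilbert–Schmidt sums -/

section HilbertSchmidt

variable {H K : Type*} [NormedAddCommGroup H] [InnerProductSpace ℂ H] [NormedAddCommGroup K]
  [InnerProductSpace ℂ K]

theorem HilbertBasis.tsum_enorm_inner_sq {ι : Type*} (e : HilbertBasis ι ℂ H) (x : H) :
    ∑' i, ‖inner ℂ (e i) x‖ₑ ^ 2 = ‖x‖ₑ ^ 2 := by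
  have h1 := e.hasSum_inner_mul_inner x x
  have h2 : ∀ i, inner ℂ x (e i) * inner ℂ (e i) x = ((‖inner ℂ (e i) x‖ ^ 2 : ℝ) : ℂ) := by
    intro i
    rw [← inner_conj_symm x (e i), Complex.conj_mul']
    push_cast
    rfl
  have h3 : (inner ℂ x x : ℂ) = ((‖x‖ ^ 2 : ℝ) : ℂ) := by
    rw [inner_self_eq_norm_sq_to_K]
    push_cast
    rfl
  simp only [h2, h3] at h1
  rw [Complex.hasSum_ofReal] at h1
  simp only [← ofReal_norm, ← ENNReal.ofReal_pow (norm_nonneg _)]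
  rw [← ENNReal.ofReal_tsum_of_nonneg (fun _ => by positivity) h1.summable, h1.tsum_eq]

/-- Parseval on both sides and an exchange of sums, unconditional in `ℝ≥0∞`. The right side does not
involve `e`, whence independence of the basis. -/
theorem tsum_enorm_apply_sq_eq [CompleteSpace H] [CompleteSpace K] {ι κ : Type*}
    (e : HilbertBasis ι ℂ H) (b : HilbertBasis κ ℂ K) (D : H →L[ℂ] K) :
    ∑' i, ‖D (e i)‖ₑ ^ 2 = ∑' j, ‖ContinuousLinearMap.adjoint D (b j)‖ₑ ^ 2 := by
  simp only [← b.tsum_enorm_inner_sq, ← e.tsum_enorm_inner_sq]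
  rw [ENNReal.tsum_comm]
  refine tsum_congr fun j => tsum_congr fun i => ?_
  rw [ContinuousLinearMap.adjoint_inner_right, ← ofReal_norm, ← ofReal_norm, norm_inner_symm]

theorem tsum_enorm_apply_comp_sq_eq [CompleteSpace H] [CompleteSpace K] {ι : Type*}
    (e : HilbertBasis ι ℂ H) (U : H ≃ₗᵢ[ℂ] H) (D : H →L[ℂ] K) :
    ∑' i, ‖D (U (e i))‖ₑ ^ 2 = ∑' i, ‖D (e i)‖ₑ ^ 2 := by
  obtain ⟨w, b, -⟩ := exists_hilbertBasis ℂ K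
  have h := tsum_enorm_apply_sq_eq (HilbertBasis.ofRepr (U.symm.trans e.repr)) b D
  rw [tsum_enorm_apply_sq_eq e b D, ← h]
  refine tsum_congr fun i => ?_
  classical
  rw [← HilbertBasis.repr_symm_single, ← HilbertBasis.repr_symm_single]
  rfl

end HilbertSchmidt

/-! ### Invariant measures from intertwining Hilbert–Schmidt operators -/

section InvariantMeasure

variable {X : Type*} [MeasurableSpace X] {m : Measure X}

theorem eLpNorm_two_sq_eq_lintegral (f : X → ℂ) (μ : Measure X) :
    eLpNorm f 2 μ ^ 2 = ∫⁻ x, ‖f x‖ₑ ^ 2 ∂μ := by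
  have h := eLpNorm_nnreal_pow_eq_lintegral (f := f) (μ := μ) (p := 2) two_ne_zero
  simpa using h

theorem enorm_LpToLpRestrictCLM_sq (B : Set X) (w : Lp ℂ 2 m) :
    ‖LpToLpRestrictCLM X ℂ ℂ m 2 B w‖ₑ ^ 2 = ∫⁻ x in B, ‖w x‖ₑ ^ 2 ∂m := by
  rw [Lp.enorm_def, eLpNorm_congr_ae (LpToLpRestrictCLM_coeFn ℂ B w), eLpNorm_two_sq_eq_lintegral]

theorem enorm_sq_eq_lintegral (w : Lp ℂ 2 m) : ‖w‖ₑ ^ 2 = ∫⁻ x, ‖w x‖ₑ ^ 2 ∂m := by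
  rw [Lp.enorm_def, eLpNorm_two_sq_eq_lintegral]

theorem NST.measurableSet_image (T : NST m) {B : Set X} (hB : MeasurableSet B) :
    MeasurableSet (T '' B) :=
  (T.toEquiv.measurableSet_image).2 hB

/-- The Koopman operator is isometric and carries `1_{TB} w` to `1_B` times the image of `w`. -/
theorem NST.setLIntegral_image [IsProbabilityMeasure m] (T : NST m) {B : Set X}
    (hB : MeasurableSet B) (w : Lp ℂ 2 m) :
    ∫⁻ x in T '' B, ‖w x‖ₑ ^ 2 ∂m = ∫⁻ x in B, ‖T.koopman w x‖ₑ ^ 2 ∂m := by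
  have hTB := T.measurableSet_image hB
  have h1 : T.koopmanFun ((T '' B).indicator w) = B.indicator (T.koopmanFun w) := by
    funext x
    have hx : T x ∈ T '' B ↔ x ∈ B := T.toEquiv.injective.mem_set_image
    by_cases h : x ∈ B
    · rw [Set.indicator_of_mem h, NST.koopmanFun, NST.koopmanFun, Set.indicator_of_mem (hx.2 h)]
    · rw [Set.indicator_of_notMem h, NST.koopmanFun, Set.indicator_of_notMem (fun h' => h (hx.1 h')),
        mul_zero]
  have h2 := T.eLpNorm_koopmanFun ((Lp.aestronglyMeasurable w).indicator hTB)
  rw [h1, eLpNorm_indicator_eq_eLpNorm_restrict hB, eLpNorm_indicator_eq_eLpNorm_restrict hTB,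
    ← eLpNorm_congr_ae (ae_restrict_of_ae (T.coeFn_koopmanMap w))] at h2
  rw [← eLpNorm_two_sq_eq_lintegral, ← h2, eLpNorm_two_sq_eq_lintegral]
  rfl

/-- The measure `B ↦ ∑ ‖1_B A eᵢ‖²`. -/
def hilbertSchmidtMeasure {ι : Type*} (A : Lp ℂ 2 m →L[ℂ] Lp ℂ 2 m) (e : ι → Lp ℂ 2 m) :
    Measure X :=
  Measure.sum fun i => m.withDensity fun x => ‖A (e i) x‖ₑ ^ 2

theorem hilbertSchmidtMeasure_apply {ι : Type*} (A : Lp ℂ 2 m →L[ℂ] Lp ℂ 2 m) (e : ι → Lp ℂ 2 m)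
    {B : Set X} (hB : MeasurableSet B) :
    hilbertSchmidtMeasure A e B = ∑' i, ∫⁻ x in B, ‖A (e i) x‖ₑ ^ 2 ∂m := by
  rw [hilbertSchmidtMeasure, Measure.sum_apply _ hB]
  exact tsum_congr fun i => withDensity_apply _ hB

theorem hilbertSchmidtMeasure_univ {ι : Type*} (A : Lp ℂ 2 m →L[ℂ] Lp ℂ 2 m)
    (e : ι → Lp ℂ 2 m) : hilbertSchmidtMeasure A e Set.univ = ∑' i, ‖A (e i)‖ₑ ^ 2 := by
  rw [hilbertSchmidtMeasure_apply A e MeasurableSet.univ]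
  simp only [Measure.restrict_univ, enorm_sq_eq_lintegral]

theorem hilbertSchmidtMeasure_absolutelyContinuous {ι : Type*} (A : Lp ℂ 2 m →L[ℂ] Lp ℂ 2 m)
    (e : ι → Lp ℂ 2 m) : hilbertSchmidtMeasure A e ≪ m := by
  refine Measure.AbsolutelyContinuous.mk fun s hs h0 => ?_
  rw [hilbertSchmidtMeasure_apply A e hs, ENNReal.tsum_eq_zero]
  exact fun i => setLIntegral_measure_zero _ _ h0

theorem hilbertSchmidtMeasure_image [IsProbabilityMeasure m] {ι : Type*}
    (A : Lp ℂ 2 m →L[ℂ] Lp ℂ 2 m) (e : HilbertBasis ι ℂ (Lp ℂ 2 m)) (T : NST m)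
    (hT : ∀ w, A (T.koopman w) = T.koopman (A w)) {B : Set X} (hB : MeasurableSet B) :
    hilbertSchmidtMeasure A e (T '' B) = hilbertSchmidtMeasure A e B := by
  rw [hilbertSchmidtMeasure_apply A e (T.measurableSet_image hB),
    hilbertSchmidtMeasure_apply A e hB]
  simp only [T.setLIntegral_image hB, ← hT, ← enorm_LpToLpRestrictCLM_sq]
  exact tsum_enorm_apply_comp_sq_eq e T.koopman ((LpToLpRestrictCLM X ℂ ℂ m 2 B).comp A)

theorem NonsingularAction.exists_isACIP {G : Type*} [Group G] [TopologicalSpace G]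
    [IsProbabilityMeasure m] (T : NonsingularAction G m) (A : Lp ℂ 2 m →L[ℂ] Lp ℂ 2 m)
    (hA : A ≠ 0) (hcomm : ∀ g x, A (T.koopmanRep g x) = T.koopmanRep g (A x)) {ι : Type*}
    (e : HilbertBasis ι ℂ (Lp ℂ 2 m)) (C : ℝ)
    (hC : ∀ s : Finset ι, ∑ i ∈ s, ‖A (e i)‖ ^ 2 ≤ C) : ∃ μ : Measure X, T.IsACIP μ := by
  set ν := hilbertSchmidtMeasure A e with hν
  have hfin : ν Set.univ ≠ ∞ := by
    rw [hν, hilbertSchmidtMeasure_univ, ENNReal.tsum_eq_iSup_sum]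
    refine ne_top_of_le_ne_top ENNReal.ofReal_ne_top (iSup_le fun s => ?_) (b := ENNReal.ofReal C)
    refine le_trans (le_of_eq ?_) (ENNReal.ofReal_le_ofReal (hC s))
    rw [ENNReal.ofReal_sum_of_nonneg fun _ _ => by positivity]
    exact Finset.sum_congr rfl fun i _ => by rw [← ofReal_norm, ENNReal.ofReal_pow (norm_nonneg _)]
  have hpos : ν Set.univ ≠ 0 := by
    rw [hν, hilbertSchmidtMeasure_univ]
    intro h0
    rw [ENNReal.tsum_eq_zero] at h0
    -- Zero total mass would make `A` vanish on a basis, whose span is dense.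
    refine hA (ContinuousLinearMap.ext_on
      (Submodule.dense_iff_topologicalClosure_eq_top.2 e.dense_span) ?_)
    rintro _ ⟨i, rfl⟩
    simpa using h0 i
  have hfin' : IsFiniteMeasure ν := ⟨hfin.lt_top⟩
  have hne : NeZero ν := ⟨fun h => hpos (by rw [h]; rfl)⟩
  refine ⟨(ν Set.univ)⁻¹ • ν, isProbabilityMeasureSMul, ?_, ?_⟩
  · exact (hilbertSchmidtMeasure_absolutelyContinuous A e).smul_left _
  · intro g B hB
    have h : ∀ w, A ((T g).koopman w) = (T g).koopman (A w) := by
      intro w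
      have h1 := hcomm g⁻¹ w
      change A ((T (g⁻¹)⁻¹).koopman w) = (T (g⁻¹)⁻¹).koopman (A w) at h1
      rwa [inv_inv] at h1
    rw [Measure.smul_apply, Measure.smul_apply, hilbertSchmidtMeasure_image A e (T g) h hB]

end InvariantMeasure

/-! ### The Koopman representation -/

section Koopman

/-- For isometries, `‖U g f - U g₀ f‖²` is expressed through `⟨U g f, U g₀ f⟩`, so weak continuity
is already strong. -/
theorem continuous_apply_of_continuous_inner {G H : Type*} [TopologicalSpace G]
    [NormedAddCommGroup H] [InnerProductSpace ℂ H] (U : G → H ≃ₗᵢ[ℂ] H)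
    (hU : ∀ f₁ f₂ : H, Continuous fun g => inner ℂ (U g f₁) f₂) (f : H) :
    Continuous fun g => U g f := by
  refine continuous_iff_continuousAt.2 fun g₀ => tendsto_iff_norm_sub_tendsto_zero.2 ?_
  have h1 : ∀ g, ‖U g f - U g₀ f‖
      = √(2 * ‖f‖ ^ 2 - 2 * (inner ℂ (U g f) (U g₀ f) : ℂ).re) := by
    intro g
    rw [eq_comm, Real.sqrt_eq_iff_mul_self_eq (by
      have := (Complex.re_le_norm _).trans (norm_inner_le_norm (𝕜 := ℂ) (U g f) (U g₀ f))
      rw [LinearIsometryEquiv.norm_map, LinearIsometryEquiv.norm_map] at this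
      nlinarith) (norm_nonneg _), ← sq, norm_sub_sq (𝕜 := ℂ), LinearIsometryEquiv.norm_map,
      LinearIsometryEquiv.norm_map]
    simp only [RCLike.re_eq_complex_re]
    ring
  simp only [h1]
  have h2 : Continuous fun g => √(2 * ‖f‖ ^ 2 - 2 * (inner ℂ (U g f) (U g₀ f) : ℂ).re) :=
    (continuous_const.sub (continuous_const.mul
      (Complex.continuous_re.comp (hU f (U g₀ f))))).sqrt
  have h3 := h2.tendsto g₀
  rw [← h1 g₀, sub_self, norm_zero] at h3
  exact h3

theorem NonsingularAction.continuous_koopmanRep {G : Type*} [Group G] [TopologicalSpace G]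
    [IsTopologicalGroup G] {X : Type*} [MeasurableSpace X] {m : Measure X} [IsProbabilityMeasure m]
    (T : NonsingularAction G m) (f : Lp ℂ 2 m) : Continuous fun g => T.koopmanRep g f :=
  continuous_apply_of_continuous_inner (fun g => T.koopmanRep g)
    (fun f₁ f₂ => (T.continuous f₁ f₂).comp continuous_inv) f

theorem NonsingularAction.hasInvariantMean_koopmanRep {G : Type*} [Group G] [TopologicalSpace G]
    [IsTopologicalGroup G] {X : Type*} [MeasurableSpace X] {m : Measure X} [IsProbabilityMeasure m]
    (T : NonsingularAction G m) (hT : ¬ ∃ μ : Measure X, T.IsACIP μ) (f₁ f₂ : Lp ℂ 2 m) :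
    HasInvariantMean (fun g => ((‖inner ℂ (T.koopmanRep g f₁) f₂‖ : ℝ) : ℂ)) 0 := by
  have hπ := T.continuous_koopmanRep
  refine ⟨⟨coefficientFun isBoundedlyLipschitz_norm (orbitMap T.koopmanRep hπ f₁)
    (InnerProductSpace.toDual ℂ _ f₂), isWeaklyAlmostPeriodic_coefficientFun _ _ hπ _ _⟩,
    fun g => ?_, fun M hM => ?_⟩
  · rw [coefficientFun_apply, InnerProductSpace.toDual_apply_apply, norm_inner_symm]
    rfl
  · by_contra hne
    obtain ⟨A, hA, hcomm, C, hC⟩ := exists_hilbertSchmidt_intertwiner T.koopmanRep f₁ hM hπ f₂ _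
      (fun g => rfl) hne
    obtain ⟨w, e, -⟩ := exists_hilbertBasis ℂ (Lp ℂ 2 m)
    exact hT (T.exists_isACIP A hA hcomm e C (hC _ e e.orthonormal))

end Koopman

end

/-- The Koopman representation is weakly mixing; the second conjunct says the same for the operators
`U_g f = √(d(m ∘ T_g)/dm) · f ∘ T_g` themselves, without the inversion `g ↦ g⁻¹`. -/
theorem mainTheorem8
    {G : Type*} [Group G] [TopologicalSpace G] [IsTopologicalGroup G]
    [LocallyCompactSpace G] [PolishSpace G]
    {X : Type*} [MeasurableSpace X] [StandardBorelSpace X]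
    (m : Measure X) [IsProbabilityMeasure m]
    (T : NonsingularAction G m)
    (hT : ¬ ∃ μ : Measure X, T.IsACIP μ) :
    IsWeaklyMixingRep T.koopmanRep ∧
      ∀ f₁ f₂ : Lp ℂ 2 m,
        HasInvariantMean (fun g : G => ((‖inner ℂ ((T g).koopman f₁) f₂‖ : ℝ) : ℂ)) 0 := by
  refine ⟨⟨T.continuous_koopmanRep, T.hasInvariantMean_koopmanRep hT⟩, fun f₁ f₂ => ?_⟩
  -- By unitarity `|⟨U_g f₁, f₂⟩| = |⟨U_{g⁻¹} f₂, f₁⟩|`; swapping the vectors absorbs the inversion.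
  convert! T.hasInvariantMean_koopmanRep hT f₂ f₁ using 3 with g
  have h : T.koopmanRep g ((T g).koopman f₁) = f₁ := by
    have e : (T g).koopman f₁ = T.koopmanRep g⁻¹ f₁ := by
      change _ = (T (g⁻¹)⁻¹).koopman f₁
      rw [inv_inv]
    rw [e, map_inv]
    exact (T.koopmanRep g).apply_symm_apply f₁
  rw [← LinearIsometryEquiv.inner_map_map (T.koopmanRep g), h, norm_inner_symm]
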